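/- Let $\mathcal{E}$ be a finite-dimensional Euclidean space, $\mathcal{L}\subseteq\mathcal{E}$ a subspace, $a\in\mathcal{E}$, $\mathcal{K}\subseteq\mathcal{E}$ a (nonempty) closed convex cone with dual cone $\mathcal{K}^*$, and suppose $(\mathcal{L}+a)\cap\mathcal{K}\neq\emptyset$. Write $P_C$ for the projection onto a closed convex set $C$, $B(\eta)=\{x:\|x\|\le\eta\}$, and $\partial\mathcal K$ for the boundary of $\mathcal K$. **Definitions.** A closed convex cone $\mathcal{C}$ and $\mathcal{L}+a$ satisfy the *PPS condition* if (1) $\mathcal{C}$ is polyhedral, or (2) $(\mathcal{L}+a)\cap\operatorname{ri}\mathcal{C}\ne\emptyset$, or (3) with respect to some direct sum decomposition $\mathcal{E}=\mathcal{E}^1\oplus\mathcal{E}^2$ one has $\mathcal{C}=\mathcal{C}^1\times\mathcal{C}^2$ with closed convex cones $\mathcal{C}^i\subseteq\mathcal{E}^i$, $\mathcal{C}^1$ polyhedral and $(\mathcal{L}+a)\cap(\mathcal{C}^1\times\operatorname{ri}\mathcal{C}^2)\neq\emptyset$. For $z\in\mathcal{K}^*$, a *one-step facial residual function* ($\mathbb{1}$-FRF)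 for $\mathcal{K}$ and $z$ is a function $\psi:\mathbb{R}_+\times\mathbb{R}_+\to\mathbb{R}_+$, nondecreasing in each argument, with $\psi(0,t)=0$ for all $t$, such that for all $x\in\operatorname{span}\mathcal{K}$ and $\epsilon\ge0$, $\operatorname{dist}(x,\mathcal{K})\le\epsilon$ and $\langle x,z\rangle\le\epsilon$ imply $\operatorname{dist}(x,\mathcal{K}\cap\{z\}^\perp)\le\psi(\epsilon,\|x\|)$. A *positively rescaled shift* of $\psi$ is a function $\hat\psi(\epsilon,t)=M_3\psi(M_1\epsilon,M_2t)+M_4\epsilon$ with constants $M_1,M_2,M_3>0$, $M_4\ge0$. A *consistent error bound function* for closed convex sets $C_1,C_2$ with $C_1\cap C_2\neq\emptyset$ is a function $\Phi:\mathbb{R}_+\times\mathbb{R}_+\to\mathbb{R}_+$, nondecreasing in each argument, with $\Phi(\cdot,b)$ right-continuous at $0$ and $\Phi(0,b)=0$ for all $b\ge0$, such that $\operatorname{dist}(x,C_1\cap C_2)\le\Phi(\max\{\operatorname{dist}(x,C_1),\operatorname{dist}(x,C_2)\},\|x\|)$ for all $x\in\mathcal{E}$. **Assumptions.** (i) $z\in\mathcal{K}^*\cap\mathcal{L}^\perp\cap\{a\}^\perp$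 and $\mathcal{F}:=\mathcal{K}\cap\{z\}^\perp$ is nontrivial, i.e. $\mathcal{F}\ne\mathcal{K}$ and $\mathcal{F}\neq\mathcal{K}\cap-\mathcal{K}$, and $\{\mathcal{F},\mathcal{L}+a\}$ satisfies the PPS condition. (ii) $\alpha\in(0,1]$, and $\mathfrak{g}:\mathbb{R}_+\to\mathbb{R}_+$ is nondecreasing with $\mathfrak{g}(0)=0$ and $\mathfrak{g}(t)\ge t^\alpha$ for all $t\ge0$. For every $\eta>0$ the number $$\gamma_{z,\eta}:=\inf_v\left\{\frac{\mathfrak{g}(\|w-v\|)}{\|w-u\|}\;\middle|\;v\in\partial\mathcal{K}\cap B(\eta)\setminus\mathcal{F},\ w=P_{\{z\}^\perp}v,\ u=P_{\mathcal{F}}w,\ w\ne u\right\}$$ lies in $(0,\infty]$. Put $\kappa_{z,\eta}:=\max\{2\eta^{1-\alpha},2\gamma_{z,\eta}^{-1}\}$ for $\eta\ge0$ (with $\gamma_{z,0}=\infty$, $\infty^{-1}=0$, $0^0=1$) and $$\psi(s,t):=\max\{s,s/\|z\|\}+\kappa_{z,t}\,\mathfrak{g}\bigl(s+\max\{s,s/\|z\|\}\bigr).$$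 (iii) (SH): there is $S>0$ such that $\mathfrak{g}(\hat\tau s)\le\hat\tau\mathfrak{g}(s)$ for all $s\in[0,S]$ and $\hat\tau\ge1$. (G1): there are $\bar v\in\mathcal{F}\setminus\{0\}$ and a continuous $w:(0,1]\to(\{z\}^\perp\cap\operatorname{span}\mathcal{K})\setminus\mathcal{F}$ with $\lim_{\epsilon\downarrow0}w_\epsilon=\bar v$ and $\limsup_{\epsilon\downarrow0}\mathfrak{g}(\operatorname{dist}(w_\epsilon,\mathcal{K}))/\operatorname{dist}(w_\epsilon,\mathcal{F})<\infty$. **Conclusions.** The function $\psi$ is a $\mathbb{1}$-FRF for $\mathcal{K}$ and $z$, and the following hold. (a) There is a positively rescaled shift $\hat\psi$ of $\psi$ such that for every bounded set $B\subseteq\mathcal{E}$ there is a constant $\kappa_B>0$, depending only on $B,\mathcal{L},a,\mathcal{F}$, such that for all $x\in B$ and $\epsilon\ge0$, $$\operatorname{dist}(x,\mathcal{K})\le\epsilon\ \text{ and }\ \operatorname{dist}(x,\mathcal{L}+a)\le\epsilon\ \Longrightarrow\ \operatorname{dist}(x,(\mathcal{L}+a)\cap\mathcal{K})\le\kappa_B\bigl(\epsilon+\hat\psi(\epsilon,\tilde\eta)\bigr),\qquad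 \tilde\eta=\sup_{x\in B}\|x\|.$$ (b) This bound is optimal in the following sense. If moreover $\|z\|=1$, $\mathcal{L}=\{z\}^\perp$ and $a=0$, then for every positively rescaled shift $\hat\psi$ of $\psi$ (in particular the one in (a)), every consistent error bound function $\Phi$ for $\mathcal{K},\mathcal{L}$ and every $\hat\eta>0$ there are $\hat\kappa>0$ and $s_0>0$ such that $$s+\hat\psi(s,\hat\eta)\le\hat\kappa\,\Phi(\hat\kappa s,\hat\eta)\qquad\text{for all } s\in[0,s_0].$$ -/

import Mathlib

open Set Filter Topology Metric
open scoped NNReal ENNReal Pointwise RealInnerProductSpace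

/-!
Conventions. `E` is a finite-dimensional Euclidean space, a closed convex cone is a term of
`ProperCone ℝ E` (in Mathlib: a closed convex cone containing `0`, with no pointedness or solidity
required), its dual cone is `ProperCone.innerDual`, `ℝ₊` is `ℝ≥0`, and the distance to a set is
`Metric.infNndist`.
-/

section FacialResiduals

variable {E : Type*} [NormedAddCommGroup E] [InnerProductSpace ℝ E]

/-- A polyhedral set: the intersection of finitely many closed half-spaces. -/
def IsPolyhedral (C : Set E) : Prop :=
  ∃ s : Finset (E × ℝ), C = {x | ∀ p ∈ s, ⟪p.1, x⟫ ≤ p.2}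

/-- The partial-polyhedral Slater condition for the closed convex cone `K` and the affine
subspace `A`: `K` is polyhedral, or `A` meets the relative interior of `K`, or `K` is a product
`K₁ × K₂` with respect to a decomposition `E = E₁ ⊕ E₂`, where `K₁` is polyhedral and `A` meets
`K₁ × ri K₂`. -/
def PPS (K : ProperCone ℝ E) (A : AffineSubspace ℝ E) : Prop :=
  IsPolyhedral (K : Set E) ∨
  ((A : Set E) ∩ intrinsicInterior ℝ (K : Set E)).Nonempty ∨
  ∃ (E₁ E₂ : Submodule ℝ E) (K₁ K₂ : ProperCone ℝ E),
    IsCompl E₁ E₂ ∧ (K₁ : Set E) ⊆ E₁ ∧ (K₂ : Set E) ⊆ E₂ ∧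
    (K : Set E) = (K₁ : Set E) + (K₂ : Set E) ∧
    IsPolyhedral (K₁ : Set E) ∧
    ((A : Set E) ∩ ((K₁ : Set E) + intrinsicInterior ℝ (K₂ : Set E))).Nonempty

/-- The face `K ∩ {z}^⊥`, exposed by `z` when `z` lies in the dual cone of `K`. -/
def exposedFace (K : ProperCone ℝ E) (z : E) : Set E := {x | x ∈ K ∧ ⟪x, z⟫ = 0}

/-- A face of `K` is nontrivial if it differs from `K` and from the lineality space `K ∩ -K`. -/
def IsNontrivialFace (K : ProperCone ℝ E) (F : Set E) : Prop :=
  F ≠ (K : Set E) ∩ -(K : Set E) ∧ F ≠ (K : Set E)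

/-- `u` is a projection (nearest point) of `x` in `C`. -/
def IsProjOnto (C : Set E) (x u : E) : Prop := u ∈ C ∧ ∀ y ∈ C, ‖x - u‖ ≤ ‖x - y‖

/-- One-step facial residual functions for `K` and `z`. -/
structure IsOneFRF (K : ProperCone ℝ E) (z : E) (ψ : ℝ≥0 → ℝ≥0 → ℝ≥0) : Prop where
  mono_left : ∀ t, Monotone fun s => ψ s t
  mono_right : ∀ s, Monotone fun t => ψ s t
  zero : ∀ t, ψ 0 t = 0
  bound : ∀ x ∈ Submodule.span ℝ (K : Set E), ∀ ε : ℝ≥0,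
    infNndist x (K : Set E) ≤ ε → ⟪x, z⟫ ≤ (ε : ℝ) → infNndist x (exposedFace K z) ≤ ψ ε ‖x‖₊

/-- `ψ'` is a positively rescaled shift of `ψ`. -/
def IsPosRescaledShift (ψ ψ' : ℝ≥0 → ℝ≥0 → ℝ≥0) : Prop :=
  ∃ M₁ M₂ M₃ M₄ : ℝ≥0, 0 < M₁ ∧ 0 < M₂ ∧ 0 < M₃ ∧
    ∀ ε t, ψ' ε t = M₃ * ψ (M₁ * ε) (M₂ * t) + M₄ * ε

/-- The set of `g(‖w - v‖) / ‖w - u‖` over `v ∈ ∂K ∩ B(η) \ F`, `w = P_{{z}^⊥} v`, `u = P_F w`,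
`w ≠ u`, where `F = K ∩ {z}^⊥`. -/
noncomputable def gammaSet (K : ProperCone ℝ E) (z : E) (g : ℝ≥0 → ℝ≥0) (η : ℝ≥0) : Set ℝ≥0∞ :=
  {r | ∃ v w u : E, v ∈ frontier (K : Set E) ∧ ‖v‖₊ ≤ η ∧ v ∉ exposedFace K z ∧
    IsProjOnto {x | ⟪x, z⟫ = 0} v w ∧ IsProjOnto (exposedFace K z) w u ∧ w ≠ u ∧
    r = (g ‖w - v‖₊ : ℝ≥0∞) / (‖w - u‖₊ : ℝ≥0∞)}

/-- `γ_{z,η} ∈ [0,∞]`, the infimum of the set above (`∞` if it is empty). -/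
noncomputable def gammaConst (K : ProperCone ℝ E) (z : E) (g : ℝ≥0 → ℝ≥0) (η : ℝ≥0) : ℝ≥0∞ :=
  sInf (gammaSet K z g η)

/-- `κ_{z,η} = max {2 η^(1-α), 2 γ_{z,η}⁻¹}`, finite as soon as `γ_{z,η} > 0`
(with `∞⁻¹ = 0` and `0^0 = 1`). -/
noncomputable def kappaConst (K : ProperCone ℝ E) (z : E) (g : ℝ≥0 → ℝ≥0) (α : ℝ) (η : ℝ≥0) :
    ℝ≥0 :=
  max (2 * η ^ (1 - α)) (2 * (gammaConst K z g η)⁻¹).toNNReal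

/-- `ψ(s,t) = max {s, s/‖z‖} + κ_{z,t} g(s + max {s, s/‖z‖})`. -/
noncomputable def psiFRF (K : ProperCone ℝ E) (z : E) (g : ℝ≥0 → ℝ≥0) (α : ℝ) :
    ℝ≥0 → ℝ≥0 → ℝ≥0 :=
  fun s t => max s (s / ‖z‖₊) + kappaConst K z g α t * g (s + max s (s / ‖z‖₊))

/-- Partial sub-homogeneity. -/
def SubHomogeneous (g : ℝ≥0 → ℝ≥0) : Prop :=
  ∃ S : ℝ≥0, 0 < S ∧ ∀ s ≤ S, ∀ τ : ℝ≥0, 1 ≤ τ → g (τ * s) ≤ τ * g s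

/-- The asymptotic optimality criterion for `g`, `K` and `z`. -/
def AsymptoticallyOptimal (K : ProperCone ℝ E) (z : E) (g : ℝ≥0 → ℝ≥0) : Prop :=
  ∃ (v : E) (w : ℝ → E), v ∈ exposedFace K z ∧ v ≠ 0 ∧ ContinuousOn w (Ioc 0 1) ∧
    (∀ ε ∈ Ioc (0 : ℝ) 1, ⟪w ε, z⟫ = 0 ∧ w ε ∈ Submodule.span ℝ (K : Set E) ∧
      w ε ∉ exposedFace K z) ∧
    Tendsto w (𝓝[>] 0) (𝓝 v) ∧
    limsup (fun ε => (g (infNndist (w ε) (K : Set E)) : ℝ≥0∞) /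
      (infNndist (w ε) (exposedFace K z) : ℝ≥0∞)) (𝓝[>] (0 : ℝ)) < ⊤

/-- Consistent error bound functions for a pair of sets. -/
structure IsConsistentErrorBound (C₁ C₂ : Set E) (Φ : ℝ≥0 → ℝ≥0 → ℝ≥0) : Prop where
  bound : ∀ x : E, infNndist x (C₁ ∩ C₂) ≤ Φ (max (infNndist x C₁) (infNndist x C₂)) ‖x‖₊
  mono_left : ∀ b, Monotone fun s => Φ s b
  right_cont : ∀ b, ContinuousWithinAt (fun s => Φ s b) (Ici 0) 0
  zero : ∀ b, Φ 0 b = 0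
  mono_right : ∀ s, Monotone fun b => Φ s b

end FacialResiduals

/-! ### Nearest points in closed convex sets and hyperplanes. -/

section NearestPoint

variable {E : Type*} [NormedAddCommGroup E] [InnerProductSpace ℝ E]

/-! Write `F` for the face `K ∩ {z}^⊥` and `A` for `L + a`.

Residual function: a point `x` nearly in `K` with `⟪x, z⟫` small is moved to its projection `q` on
`{z}^⊥`, at a cost linear in `ε`. If `v` is the projection of `q` on `K`, `w` that of `v` on `{z}^⊥`
and `u` that of `w` on `F`, then `dist (q, F) ≤ ‖q - w‖ + ‖w - u‖`. The first term is at most `‖q -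
v‖`, which `g t ≥ t ^ α` controls on bounded sets; the second is controlled by `γ`. Each gets half
of `κ` (`infDist_exposedFace_le`).

Error bound (a): `A ⊆ {z}^⊥`, so `A ∩ K = A ∩ F`. The PPS condition makes `A` and `F` linearly
regular on bounded sets (`PPS.exists_infNndist_inter_le`, resting on Hoffman's bound), and the
residual function bounds the distance to `F`.

Optimality (b): near `0`, (SH) and `s ≤ s ^ α ≤ g s` make every rescaled shift `O(g)`. Conversely
the curve in (G1) meets every small distance `s` to `K` while staying in `{z}^⊥` and at distance at
least a multiple of `g s` from `F`. Rescaled into the ball of radius `η`, its points force `Φ` to be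
at least of order `g`. -/

theorem exists_isProjOnto [FiniteDimensional ℝ E] {C : Set E} (hC : IsClosed C)
    (hne : C.Nonempty) (x : E) : ∃ u, IsProjOnto C x u ∧ infDist x C = ‖x - u‖ := by
  obtain ⟨u, hu, h⟩ := hC.exists_infDist_eq_dist hne x
  rw [dist_eq_norm] at h
  refine ⟨u, ⟨hu, fun y hy => ?_⟩, h⟩
  rw [← h, ← dist_eq_norm]
  exact infDist_le_dist_of_mem hy

theorem IsProjOnto.inner_le_zero {C : Set E} (hC : Convex ℝ C) {x u y : E}
    (h : IsProjOnto C x u) (hy : y ∈ C) : ⟪x - u, y - u⟫ ≤ 0 := by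
  refine (norm_eq_iInf_iff_real_inner_le_zero hC h.1).1 ?_ y hy
  have : Nonempty C := ⟨⟨u, h.1⟩⟩
  refine le_antisymm (le_ciInf fun w => h.2 w w.2) ?_
  exact ciInf_le ⟨0, by rintro _ ⟨w, rfl⟩; exact norm_nonneg _⟩ (⟨u, h.1⟩ : C)

theorem IsProjOnto.norm_sub_le {C : Set E} (hC : Convex ℝ C) {x u y : E}
    (h : IsProjOnto C x u) (hy : y ∈ C) : ‖u - y‖ ≤ ‖x - y‖ := by
  have h1 := h.inner_le_zero hC hy
  have h2 : ‖x - y‖ ^ 2 = ‖x - u‖ ^ 2 - 2 * ⟪x - u, y - u⟫ + ‖u - y‖ ^ 2 := by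
    rw [norm_sub_rev u y, ← norm_sub_sq_real]
    congr 2
    abel
  refine le_of_sq_le_sq ?_ (norm_nonneg _)
  nlinarith [sq_nonneg ‖x - u‖]

theorem IsProjOnto.mem_frontier {C : Set E} {x u : E} (h : IsProjOnto C x u) (hx : x ∉ C) :
    u ∈ frontier C := by
  -- From an interior point `u`, a short step towards `x` would stay in `C` and be strictly closer
  -- to `x`.
  refine ⟨subset_closure h.1, fun hint => hx ?_⟩
  have hc : Tendsto (fun t : ℝ => u + t • (x - u)) (𝓝[>] 0) (𝓝 u) := by
    have : Continuous fun t : ℝ => u + t • (x - u) := by fun_prop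
    simpa using (this.tendsto 0).mono_left nhdsWithin_le_nhds
  have h1 := hc.eventually (mem_interior_iff_mem_nhds.1 hint)
  have h2 : ∀ᶠ t : ℝ in 𝓝[>] 0, t ∈ Ioo (0 : ℝ) 1 := Ioo_mem_nhdsGT one_pos
  obtain ⟨t, ht, ht0, ht1⟩ := (h1.and h2).exists
  have h3 := h.2 _ ht
  rw [show x - (u + t • (x - u)) = (1 - t) • (x - u) by module, norm_smul, Real.norm_eq_abs,
    abs_of_pos (by linarith)] at h3
  have h4 : ‖x - u‖ = 0 := by nlinarith [norm_nonneg (x - u)]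
  rw [norm_sub_eq_zero_iff.1 h4]
  exact h.1

theorem infDist_hyperplane_le {z : E} (hz : z ≠ 0) (x : E) :
    infDist x {y | ⟪y, z⟫ = 0} ≤ |⟪x, z⟫| / ‖z‖ := by
  have hz' : ‖z‖ ≠ 0 := norm_ne_zero_iff.2 hz
  have hmem : x - (⟪x, z⟫ / ‖z‖ ^ 2) • z ∈ {y : E | ⟪y, z⟫ = 0} := by
    simp only [mem_ofPred_eq, inner_sub_left, real_inner_smul_left, real_inner_self_eq_norm_sq]
    field_simp
    ring
  refine (infDist_le_dist_of_mem hmem).trans_eq ?_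
  rw [dist_eq_norm, sub_sub_cancel, norm_smul, Real.norm_eq_abs, abs_div, abs_of_nonneg
    (sq_nonneg ‖z‖)]
  field_simp

theorem isClosed_hyperplane (z : E) : IsClosed {x : E | ⟪x, z⟫ = 0} :=
  isClosed_eq (by fun_prop) continuous_const

theorem convex_hyperplane_inner (z : E) : Convex ℝ {x : E | ⟪x, z⟫ = 0} := by
  intro x hx y hy s t _ _ _
  simp only [mem_ofPred_eq] at *
  simp [inner_add_left, real_inner_smul_left, hx, hy]

end NearestPoint

/-! ### The function `ψ` as a one-step facial residual function. -/

section ResidualFunction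

variable {E : Type*} [NormedAddCommGroup E] [InnerProductSpace ℝ E]

theorem exposedFace_eq (K : ProperCone ℝ E) (z : E) :
    exposedFace K z = (K : Set E) ∩ {x | ⟪x, z⟫ = 0} := rfl

theorem isClosed_exposedFace (K : ProperCone ℝ E) (z : E) : IsClosed (exposedFace K z) :=
  K.isClosed.inter (isClosed_hyperplane z)

theorem zero_mem_exposedFace (K : ProperCone ℝ E) (z : E) : (0 : E) ∈ exposedFace K z :=
  ⟨K.zero_mem, inner_zero_left _⟩

theorem convex_properCone (K : ProperCone ℝ E) : Convex ℝ (K : Set E) :=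
  PointedCone.convex (K : PointedCone ℝ E)

variable {K : ProperCone ℝ E} {z : E} {g : ℝ≥0 → ℝ≥0} {α : ℝ}

theorem gammaConst_anti {η₁ η₂ : ℝ≥0} (h : η₁ ≤ η₂) :
    gammaConst K z g η₂ ≤ gammaConst K z g η₁ := by
  refine sInf_le_sInf ?_
  rintro r ⟨v, w, u, hv, hη, h'⟩
  exact ⟨v, w, u, hv, hη.trans h, h'⟩

/-- Antitonicity in the radius extends positivity to `η = 0`. -/
theorem gammaConst_pos (hγ : ∀ η : ℝ≥0, 0 < η → 0 < gammaConst K z g η) (η : ℝ≥0) :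
    0 < gammaConst K z g η :=
  (hγ (η + 1) (by positivity)).trans_le (gammaConst_anti le_self_add)

theorem two_mul_gammaConst_inv_ne_top (hγ : ∀ η : ℝ≥0, 0 < η → 0 < gammaConst K z g η)
    (η : ℝ≥0) : 2 * (gammaConst K z g η)⁻¹ ≠ ⊤ :=
  ENNReal.mul_ne_top (by simp) (ENNReal.inv_ne_top.2 (gammaConst_pos hγ η).ne')

theorem kappaConst_mono (hα : α ≤ 1) (hγ : ∀ η : ℝ≥0, 0 < η → 0 < gammaConst K z g η) :
    Monotone (kappaConst K z g α) := by
  intro η₁ η₂ h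
  refine max_le_max ?_ ?_
  · gcongr
  · refine ENNReal.toNNReal_mono (two_mul_gammaConst_inv_ne_top hγ _) ?_
    gcongr
    exact gammaConst_anti h

theorem norm_sub_le_of_mem_gammaSet (hγ : ∀ η : ℝ≥0, 0 < η → 0 < gammaConst K z g η)
    {η : ℝ≥0} {v w u : E} (hv : v ∈ frontier (K : Set E)) (hη : ‖v‖₊ ≤ η)
    (hF : v ∉ exposedFace K z) (hw : IsProjOnto {x | ⟪x, z⟫ = 0} v w)
    (hu : IsProjOnto (exposedFace K z) w u) :
    2 * ‖w - u‖₊ ≤ kappaConst K z g α η * g ‖w - v‖₊ := by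
  rcases eq_or_ne w u with rfl | hne
  · simp
  have hwu : ‖w - u‖₊ ≠ 0 := by simpa [sub_eq_zero] using hne
  have hle : gammaConst K z g η ≤ (g ‖w - v‖₊ : ℝ≥0∞) / (‖w - u‖₊ : ℝ≥0∞) :=
    sInf_le ⟨v, w, u, hv, hη, hF, hw, hu, hne, rfl⟩
  have htop : gammaConst K z g η ≠ ⊤ := by
    refine ne_top_of_le_ne_top (ENNReal.div_ne_top (by simp) (by simpa using hwu)) hle
  have hpos := gammaConst_pos hγ η
  obtain ⟨γ, hγdef⟩ : ∃ γ : ℝ≥0, (γ : ℝ≥0∞) = gammaConst K z g η := ⟨_, ENNReal.coe_toNNReal htop⟩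
  rw [← hγdef] at hpos hle
  have hγ0 : γ ≠ 0 := by rintro rfl; simp at hpos
  have h2 : 2 * γ⁻¹ ≤ kappaConst K z g α η := by
    refine le_trans (le_of_eq ?_) (le_max_right _ _)
    rw [← hγdef, ← ENNReal.coe_inv hγ0]
    norm_cast
  rw [← ENNReal.coe_div hwu, ENNReal.coe_le_coe, le_div_iff₀ (by positivity)] at hle
  calc 2 * ‖w - u‖₊ = 2 * γ⁻¹ * (γ * ‖w - u‖₊) := by field_simp
    _ ≤ kappaConst K z g α η * g ‖w - v‖₊ := mul_le_mul' h2 hle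

/-- The core estimate, for points already in `{z}^⊥`: the path from `q` through `w` to `u` has two
legs, each bounded by `κ / 2 * g (dist (q, K))`. -/
theorem infDist_exposedFace_le [FiniteDimensional ℝ E] (hα : α ≤ 1)
    (hg : Monotone g) (hgα : ∀ t : ℝ≥0, t ^ α ≤ g t)
    (hγ : ∀ η : ℝ≥0, 0 < η → 0 < gammaConst K z g η) {q : E} (hq : ⟪q, z⟫ = 0) :
    infDist q (exposedFace K z) ≤ kappaConst K z g α ‖q‖₊ * g (infNndist q K) := by
  by_cases hqK : q ∈ K
  · rw [infDist_zero_of_mem (show q ∈ exposedFace K z from ⟨hqK, hq⟩)]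
    positivity
  obtain ⟨v, hv, hdv⟩ := exists_isProjOnto K.isClosed ⟨0, K.zero_mem⟩ q
  have hd : infNndist q (K : Set E) = ‖q - v‖₊ := by
    rw [← NNReal.coe_inj, coe_infNndist, hdv, coe_nnnorm]
  rw [hd]
  have hvn : ‖v‖₊ ≤ ‖q‖₊ := by
    simpa [← NNReal.coe_le_coe] using hv.norm_sub_le (convex_properCone K) K.zero_mem
  have hqv : ‖q - v‖₊ ≤ ‖q‖₊ := by simpa [← NNReal.coe_le_coe] using hv.2 0 K.zero_mem
  -- Split `t = t ^ (1 - α) * t ^ α` with `t = ‖q - v‖ ≤ ‖q‖`; this is where the term `2 η ^ (1 -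
  -- α)` of `κ` is used.
  have hlin : 2 * ‖q - v‖₊ ≤ kappaConst K z g α ‖q‖₊ * g ‖q - v‖₊ := by
    calc 2 * ‖q - v‖₊ = 2 * ‖q - v‖₊ ^ (1 - α) * ‖q - v‖₊ ^ α := by
          have : ‖q - v‖₊ ≠ 0 := by
            rw [nnnorm_ne_zero_iff, sub_ne_zero]
            rintro rfl
            exact hqK hv.1
          rw [mul_assoc, ← NNReal.rpow_add this]
          simp
      _ ≤ kappaConst K z g α ‖q‖₊ * g ‖q - v‖₊ := by
          refine mul_le_mul' (le_trans ?_ (le_max_left _ _)) (hgα _)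
          gcongr
  have hlin' : 2 * ‖q - v‖ ≤ kappaConst K z g α ‖q‖₊ * g ‖q - v‖₊ := by exact_mod_cast hlin
  by_cases hvF : v ∈ exposedFace K z
  · have := infDist_le_dist_of_mem (x := q) hvF
    rw [dist_eq_norm] at this
    linarith [norm_nonneg (q - v)]
  obtain ⟨w, hw, -⟩ := exists_isProjOnto (isClosed_hyperplane z) ⟨q, hq⟩ v
  obtain ⟨u, hu, -⟩ := exists_isProjOnto (isClosed_exposedFace K z)
    ⟨0, zero_mem_exposedFace K z⟩ w
  have h1 := norm_sub_le_of_mem_gammaSet (α := α) hγ (hv.mem_frontier hqK) hvn hvF hw hu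
  have h2 : ‖w - v‖₊ ≤ ‖q - v‖₊ := by
    have := hw.2 q hq
    rwa [norm_sub_rev, norm_sub_rev v q] at this
  have h3 : 2 * ‖w - u‖ ≤ kappaConst K z g α ‖q‖₊ * g ‖q - v‖₊ := by
    exact_mod_cast h1.trans (mul_le_mul_right (hg h2) _)
  -- `q` is its own projection on `{z}^⊥`, and projecting `v` there brings it no farther from `q`.
  have h4 : ‖q - w‖ ≤ ‖q - v‖ := by
    rw [norm_sub_rev, norm_sub_rev q v]
    exact hw.norm_sub_le (convex_hyperplane_inner z) hq
  have h5 := infDist_le_dist_of_mem (x := q) hu.1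
  have h6 := norm_sub_le_norm_sub_add_norm_sub q w u
  rw [dist_eq_norm] at h5
  linarith

theorem infNndist_exposedFace_le_psiFRF [FiniteDimensional ℝ E] (hz : z ≠ 0)
    (hzK : z ∈ ProperCone.innerDual (K : Set E)) (hα : α ≤ 1)
    (hg : Monotone g) (hgα : ∀ t : ℝ≥0, t ^ α ≤ g t)
    (hγ : ∀ η : ℝ≥0, 0 < η → 0 < gammaConst K z g η) {x : E} {ε : ℝ≥0}
    (hxK : infNndist x (K : Set E) ≤ ε) (hxz : ⟪x, z⟫ ≤ (ε : ℝ)) :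
    infNndist x (exposedFace K z) ≤ psiFRF K z g α ε ‖x‖₊ := by
  have hz' : 0 < ‖z‖ := norm_pos_iff.2 hz
  obtain ⟨q, hq, hdq⟩ := exists_isProjOnto (isClosed_hyperplane z) ⟨0, inner_zero_left z⟩ x
  obtain ⟨k, hk, hdk⟩ := exists_isProjOnto K.isClosed ⟨0, K.zero_mem⟩ x
  have hxK' : ‖x - k‖ ≤ ε := by rw [← hdk, ← coe_infNndist]; exact_mod_cast hxK
  -- `m` must bound `|⟪x, z⟫| / ‖z‖`. The entry `ε / ‖z‖` serves the upper bound on `⟪x, z⟫`; the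
  -- entry `ε` serves the lower bound, which comes from `⟪k, z⟫ ≥ 0`.
  set m : ℝ≥0 := max ε (ε / ‖z‖₊) with hm
  have hxq : ‖x - q‖ ≤ m := by
    rw [← hdq]
    refine (infDist_hyperplane_le hz x).trans ?_
    rw [div_le_iff₀ hz', abs_le]
    have hm1 : (ε : ℝ) ≤ m := by exact_mod_cast le_max_left ε (ε / ‖z‖₊)
    have hm2 : (ε : ℝ) ≤ m * ‖z‖ := by
      have : (ε / ‖z‖₊ : ℝ≥0) ≤ m := le_max_right ε (ε / ‖z‖₊)
      rw [div_le_iff₀ (by simpa using hz)] at this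
      exact_mod_cast this
    have hkz : 0 ≤ ⟪k, z⟫ := ProperCone.mem_innerDual.1 hzK hk.1
    have h1 : |⟪x - k, z⟫| ≤ ‖x - k‖ * ‖z‖ := abs_real_inner_le_norm _ _
    have h2 := (abs_le.1 h1).1
    rw [inner_sub_left] at h2
    constructor
    · nlinarith
    · linarith
  have hqx : ‖q‖₊ ≤ ‖x‖₊ := by
    simpa [← NNReal.coe_le_coe] using hq.norm_sub_le (convex_hyperplane_inner z) (inner_zero_left z)
  have hqK : infNndist q (K : Set E) ≤ ε + m := by
    rw [← NNReal.coe_le_coe, coe_infNndist]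
    have h1 := infDist_le_dist_of_mem (x := q) hk.1
    have h2 := norm_sub_le_norm_sub_add_norm_sub q x k
    rw [dist_eq_norm] at h1
    rw [norm_sub_rev q x] at h2
    push_cast
    linarith
  have h1 := infDist_exposedFace_le (K := K) (α := α) hα hg hgα hγ hq.1
  have h2 : kappaConst K z g α ‖q‖₊ * g (infNndist q K) ≤
      kappaConst K z g α ‖x‖₊ * g (ε + m) :=
    mul_le_mul' (kappaConst_mono hα hγ hqx) (hg hqK)
  have h3 := infDist_le_infDist_add_dist (s := exposedFace K z) (x := x) (y := q)
  rw [dist_eq_norm] at h3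
  rw [← NNReal.coe_le_coe, coe_infNndist, psiFRF]
  have h4 : (kappaConst K z g α ‖q‖₊ * g (infNndist q K) : ℝ) ≤
      kappaConst K z g α ‖x‖₊ * g (ε + m) := by exact_mod_cast h2
  push_cast at h4 ⊢
  have h5 : (m : ℝ) = max (ε : ℝ) (ε / ‖z‖) := by simp [hm]
  rw [← h5]
  linarith

theorem psiFRF_mono_left (hg : Monotone g) (t : ℝ≥0) : Monotone fun s => psiFRF K z g α s t := by
  intro s₁ s₂ h
  have hm : max s₁ (s₁ / ‖z‖₊) ≤ max s₂ (s₂ / ‖z‖₊) := by gcongr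
  exact add_le_add hm (mul_le_mul_right (hg (add_le_add h hm)) _)

theorem psiFRF_mono_right (hα : α ≤ 1) (hγ : ∀ η : ℝ≥0, 0 < η → 0 < gammaConst K z g η)
    (s : ℝ≥0) : Monotone fun t => psiFRF K z g α s t := by
  intro t₁ t₂ h
  exact add_le_add le_rfl (mul_le_mul_left (kappaConst_mono hα hγ h) _)

theorem isOneFRF_psiFRF [FiniteDimensional ℝ E] (hz : z ≠ 0)
    (hzK : z ∈ ProperCone.innerDual (K : Set E)) (hα : α ≤ 1)
    (hg : Monotone g) (hg0 : g 0 = 0) (hgα : ∀ t : ℝ≥0, t ^ α ≤ g t)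
    (hγ : ∀ η : ℝ≥0, 0 < η → 0 < gammaConst K z g η) :
    IsOneFRF K z (psiFRF K z g α) where
  mono_left := psiFRF_mono_left hg
  mono_right := psiFRF_mono_right hα hγ
  zero t := by simp [psiFRF, hg0]
  bound _ _ _ := infNndist_exposedFace_le_psiFRF hz hzK hα hg hgα hγ

end ResidualFunction

/-! ### Hoffman's error bound. -/

section Hoffman

variable {E : Type*} [NormedAddCommGroup E] [InnerProductSpace ℝ E]

/-- On the polar of the cone `{t | ∀ p ∈ J, ⟪p.1, t⟫ ≤ 0}`, the total violation of the
inequalities dominates a multiple of the norm. -/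
theorem exists_mul_norm_le_sum_posPart [FiniteDimensional ℝ E] (J : Finset (E × ℝ)) :
    ∃ m : ℝ, 0 < m ∧ ∀ d : E, (∀ t : E, (∀ p ∈ J, ⟪p.1, t⟫ ≤ 0) → ⟪d, t⟫ ≤ 0) →
      m * ‖d‖ ≤ ∑ p ∈ J, max ⟪p.1, d⟫ 0 := by
  set N : Set E := {d | ∀ t : E, (∀ p ∈ J, ⟪p.1, t⟫ ≤ 0) → ⟪d, t⟫ ≤ 0} with hN
  have hNc : IsClosed N := by
    simp only [hN, ofPred_forall]
    exact isClosed_iInter fun t => isClosed_iInter fun _ =>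
      isClosed_le (by fun_prop) continuous_const
  have hcomp : IsCompact (N ∩ sphere 0 1) := (isCompact_sphere 0 1).inter_left hNc
  have hcont : Continuous fun d : E => ∑ p ∈ J, max ⟪p.1, d⟫ 0 := by fun_prop
  have hpos : ∀ d ∈ N ∩ sphere 0 1, 0 < ∑ p ∈ J, max ⟪p.1, d⟫ 0 := by
    rintro d ⟨hdN, hd1⟩
    by_contra! hle
    have h0 : ∀ p ∈ J, max ⟪p.1, d⟫ 0 = 0 :=
      (Finset.sum_eq_zero_iff_of_nonneg fun p _ => le_max_right _ _).1
        (le_antisymm hle (Finset.sum_nonneg fun p _ => le_max_right _ _))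
    -- With no violation `d` lies in the cone as well as in its polar, so `t = d` is a legitimate
    -- test vector.
    have h1 : ⟪d, d⟫ ≤ 0 := hdN d fun p hp => by simpa using h0 p hp
    rw [real_inner_self_eq_norm_sq, mem_sphere_zero_iff_norm.1 hd1] at h1
    norm_num at h1
  obtain ⟨m, hm, hmle⟩ : ∃ m : ℝ, 0 < m ∧ ∀ d ∈ N ∩ sphere 0 1,
      m ≤ ∑ p ∈ J, max ⟪p.1, d⟫ 0 := by
    rcases (N ∩ sphere 0 1).eq_empty_or_nonempty with he | hne
    · exact ⟨1, one_pos, by simp [he]⟩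
    · obtain ⟨d₀, hd₀, hmin⟩ := hcomp.exists_isMinOn hne hcont.continuousOn
      exact ⟨_, hpos d₀ hd₀, fun d hd => hmin hd⟩
  refine ⟨m, hm, fun d hd => ?_⟩
  rcases eq_or_ne d 0 with rfl | hd0
  · simp
  have hdn : 0 < ‖d‖ := norm_pos_iff.2 hd0
  have hmem : ‖d‖⁻¹ • d ∈ N ∩ sphere 0 1 := by
    refine ⟨fun t ht => ?_, ?_⟩
    · rw [real_inner_smul_left]
      exact mul_nonpos_of_nonneg_of_nonpos (by positivity) (hd t ht)
    · rw [mem_sphere_zero_iff_norm, norm_smul, norm_inv, norm_norm, inv_mul_cancel₀ hdn.ne']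
  have h := hmle _ hmem
  have hs : ∑ p ∈ J, max ⟪p.1, ‖d‖⁻¹ • d⟫ 0 = ‖d‖⁻¹ * ∑ p ∈ J, max ⟪p.1, d⟫ 0 := by
    rw [Finset.mul_sum]
    refine Finset.sum_congr rfl fun p _ => ?_
    rw [real_inner_smul_right, mul_max_of_nonneg _ _ (by positivity), mul_zero]
  rw [hs, inv_mul_eq_div, le_div_iff₀ hdn] at h
  exact h

theorem convex_setOf_forall_inner_le (s : Finset (E × ℝ)) :
    Convex ℝ {x : E | ∀ p ∈ s, ⟪p.1, x⟫ ≤ p.2} := by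
  simp only [ofPred_forall]
  refine convex_iInter fun p => convex_iInter fun _ => ?_
  exact convex_halfSpace_le (f := fun x => ⟪p.1, x⟫)
    ⟨fun x y => inner_add_right _ _ _, fun c x => real_inner_smul_right _ _ _⟩ p.2

theorem isClosed_setOf_forall_inner_le (s : Finset (E × ℝ)) :
    IsClosed {x : E | ∀ p ∈ s, ⟪p.1, x⟫ ≤ p.2} := by
  simp only [ofPred_forall]
  exact isClosed_iInter fun p => isClosed_iInter fun _ =>
    isClosed_le (by fun_prop) continuous_const

/-- Hoffman's error bound for a consistent system of linear inequalities. -/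
theorem exists_infDist_le_mul_sum_posPart [FiniteDimensional ℝ E] (s : Finset (E × ℝ))
    (hne : {x : E | ∀ p ∈ s, ⟪p.1, x⟫ ≤ p.2}.Nonempty) :
    ∃ c : ℝ, 0 < c ∧ ∀ x : E, infDist x {x : E | ∀ p ∈ s, ⟪p.1, x⟫ ≤ p.2} ≤
      c * ∑ p ∈ s, max (⟪p.1, x⟫ - p.2) 0 := by
  classical
  choose m hm hmle using exists_mul_norm_le_sum_posPart (E := E)
  -- The active set `J` depends on `x`; summing over all subsets of `s` gives a constant valid for
  -- every one.
  refine ⟨∑ J ∈ s.powerset, (m J)⁻¹, Finset.sum_pos (fun J _ => inv_pos.2 (hm J))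
    ⟨∅, Finset.empty_mem_powerset s⟩, fun x => ?_⟩
  obtain ⟨y, hy, hdy⟩ := exists_isProjOnto (isClosed_setOf_forall_inner_le s) hne x
  set J := s.filter fun p => ⟪p.1, y⟫ = p.2 with hJ
  -- `x - y` is normal at `y`: a direction violating no active constraint remains feasible for a
  -- short time, since inactive constraints have slack.
  have hpolar : ∀ t : E, (∀ p ∈ J, ⟪p.1, t⟫ ≤ 0) → ⟪x - y, t⟫ ≤ 0 := by
    intro t ht
    have hev : ∀ᶠ r : ℝ in 𝓝[>] 0, ∀ p ∈ s, ⟪p.1, y + r • t⟫ ≤ p.2 := by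
      rw [Filter.eventually_all_finset]
      intro p hp
      rcases (hy.1 p hp).eq_or_lt with he | hlt
      · filter_upwards [self_mem_nhdsWithin] with r hr
        rw [inner_add_right, real_inner_smul_right, he]
        have := mul_nonpos_of_nonneg_of_nonpos (le_of_lt hr) (ht p (by simp [hJ, hp, he]))
        linarith
      · have hc : Continuous fun r : ℝ => ⟪p.1, y + r • t⟫ := by fun_prop
        have hlim := (hc.tendsto 0).mono_left (nhdsWithin_le_nhds (s := Ioi 0))
        have h0 : ⟪p.1, y + (0 : ℝ) • t⟫ < p.2 := by simpa using hlt
        filter_upwards [hlim.eventually_lt_const h0] with r hr using hr.le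
    obtain ⟨r, hr, hr0⟩ := (hev.and self_mem_nhdsWithin).exists
    have h := hy.inner_le_zero (convex_setOf_forall_inner_le s) hr
    rw [add_sub_cancel_left, real_inner_smul_right] at h
    exact nonpos_of_mul_nonpos_right h hr0
  have h1 := hmle J (x - y) hpolar
  have h2 : ∑ p ∈ J, max ⟪p.1, x - y⟫ 0 ≤ ∑ p ∈ s, max (⟪p.1, x⟫ - p.2) 0 := by
    refine le_trans (Finset.sum_le_sum fun p hp => le_of_eq ?_)
      (Finset.sum_le_sum_of_subset_of_nonneg (Finset.filter_subset _ s)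
        fun p _ _ => le_max_right _ _)
    rw [inner_sub_right, (Finset.mem_filter.1 hp).2]
  have h3 : (m J)⁻¹ ≤ ∑ J ∈ s.powerset, (m J)⁻¹ :=
    Finset.single_le_sum (f := fun J => (m J)⁻¹) (fun J _ => (inv_pos.2 (hm J)).le)
      (Finset.mem_powerset.2 (Finset.filter_subset _ s))
  have h4 : 0 ≤ ∑ p ∈ s, max (⟪p.1, x⟫ - p.2) 0 := Finset.sum_nonneg fun p _ => le_max_right _ _
  calc infDist x {x : E | ∀ p ∈ s, ⟪p.1, x⟫ ≤ p.2} = ‖x - y‖ := hdy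
    _ ≤ (m J)⁻¹ * ∑ p ∈ s, max (⟪p.1, x⟫ - p.2) 0 := by
        rw [inv_mul_eq_div, le_div_iff₀ (hm J)]
        linarith
    _ ≤ _ := mul_le_mul_of_nonneg_right h3 h4

end Hoffman

/-! ### Polyhedral sets and their linear regularity. -/

section Polyhedral

variable {E : Type*} [NormedAddCommGroup E] [InnerProductSpace ℝ E]

theorem isPolyhedral_univ : IsPolyhedral (univ : Set E) := ⟨∅, by simp⟩

theorem IsPolyhedral.inter {C D : Set E} (hC : IsPolyhedral C) (hD : IsPolyhedral D) :
    IsPolyhedral (C ∩ D) := by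
  classical
  obtain ⟨s, rfl⟩ := hC
  obtain ⟨t, rfl⟩ := hD
  refine ⟨s ∪ t, ?_⟩
  ext x
  simp only [mem_inter_iff, mem_ofPred_eq, Finset.mem_union]
  exact ⟨fun h p hp => hp.elim (h.1 p) (h.2 p),
    fun h => ⟨fun p hp => h p (Or.inl hp), fun p hp => h p (Or.inr hp)⟩⟩

theorem IsPolyhedral.isClosed {C : Set E} (hC : IsPolyhedral C) : IsClosed C := by
  obtain ⟨s, rfl⟩ := hC
  exact isClosed_setOf_forall_inner_le s

theorem IsPolyhedral.convex {C : Set E} (hC : IsPolyhedral C) : Convex ℝ C := by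
  obtain ⟨s, rfl⟩ := hC
  exact convex_setOf_forall_inner_le s

theorem IsPolyhedral.preimage [FiniteDimensional ℝ E] {C : Set E} (hC : IsPolyhedral C)
    (f : E →ₗ[ℝ] E) : IsPolyhedral (f ⁻¹' C) := by
  classical
  obtain ⟨s, rfl⟩ := hC
  refine ⟨s.image fun p => (f.adjoint p.1, p.2), ?_⟩
  ext x
  simp only [mem_preimage, mem_ofPred_eq, Finset.forall_mem_image, LinearMap.adjoint_inner_left]

theorem isPolyhedral_affineSubspace [FiniteDimensional ℝ E] (A : AffineSubspace ℝ E)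
    (hA : (A : Set E).Nonempty) : IsPolyhedral (A : Set E) := by
  classical
  obtain ⟨a, ha⟩ := hA
  -- A finite spanning set of normals; each equation becomes two opposite inequalities.
  obtain ⟨b, hb⟩ := IsNoetherian.noetherian (A.direction)ᗮ
  refine ⟨b.image (fun v => (v, ⟪v, a⟫)) ∪ b.image (fun v => (-v, ⟪-v, a⟫)), ?_⟩
  ext x
  have h1 : x ∈ (A : Set E) ↔ x - a ∈ A.direction := by
    rw [← vsub_eq_sub, AffineSubspace.vsub_right_mem_direction_iff_mem ha]
    rfl
  have h2 : x - a ∈ A.direction ↔ ∀ v ∈ b, ⟪v, x - a⟫ = 0 := by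
    rw [← Submodule.orthogonal_orthogonal A.direction, Submodule.mem_orthogonal, ← hb]
    refine ⟨fun h v hv => h v (Submodule.subset_span hv), fun h u hu => ?_⟩
    induction hu using Submodule.span_induction with
    | mem v hv => exact h v hv
    | zero => simp
    | add u v _ _ hu hv => rw [inner_add_left, hu, hv, add_zero]
    | smul c u _ hu => rw [real_inner_smul_left, hu, mul_zero]
  rw [h1, h2]
  simp only [mem_ofPred_eq, Finset.mem_union, Finset.mem_image]
  constructor
  · rintro h p (⟨v, hv, rfl⟩ | ⟨v, hv, rfl⟩)
    · have := h v hv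
      rw [inner_sub_right] at this
      simp only
      linarith
    · have := h v hv
      rw [inner_sub_right] at this
      simp only [inner_neg_left]
      linarith
  · intro h v hv
    have h3 := h _ (Or.inl ⟨v, hv, rfl⟩)
    have h4 := h _ (Or.inr ⟨v, hv, rfl⟩)
    simp only [inner_neg_left] at h3 h4
    rw [inner_sub_right]
    linarith

/-- Linear regularity of two polyhedral sets. -/
theorem IsPolyhedral.exists_infDist_inter_le [FiniteDimensional ℝ E] {C D : Set E}
    (hC : IsPolyhedral C) (hD : IsPolyhedral D) (hne : (C ∩ D).Nonempty) :
    ∃ c : ℝ, 0 < c ∧ ∀ (x : E) (ε : ℝ), infDist x C ≤ ε → infDist x D ≤ ε →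
      infDist x (C ∩ D) ≤ c * ε := by
  classical
  obtain ⟨s, hs⟩ := hC
  obtain ⟨t, ht⟩ := hD
  have hCD : C ∩ D = {x | ∀ p ∈ s ∪ t, ⟪p.1, x⟫ ≤ p.2} := by
    rw [hs, ht]
    ext x
    simp only [mem_inter_iff, mem_ofPred_eq, Finset.mem_union]
    exact ⟨fun h p hp => hp.elim (h.1 p) (h.2 p),
      fun h => ⟨fun p hp => h p (Or.inl hp), fun p hp => h p (Or.inr hp)⟩⟩
  have hviol : ∀ (r : Finset (E × ℝ)) (S : Set E), S = {x | ∀ p ∈ r, ⟪p.1, x⟫ ≤ p.2} →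
      S.Nonempty → ∀ (x : E) (ε : ℝ), infDist x S ≤ ε → ∀ p ∈ r,
        max (⟪p.1, x⟫ - p.2) 0 ≤ ‖p.1‖ * ε := by
    rintro r S hS hSne x ε hx p hp
    obtain ⟨y, hy, hxy⟩ := exists_isProjOnto
      (show IsClosed S by rw [hS]; exact isClosed_setOf_forall_inner_le r) hSne x
    have hε : 0 ≤ ε := infDist_nonneg.trans hx
    have hyp : ⟪p.1, y⟫ ≤ p.2 := (hS ▸ hy.1 : y ∈ {x | ∀ p ∈ r, ⟪p.1, x⟫ ≤ p.2}) p hp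
    have h1 := real_inner_le_norm p.1 (x - y)
    have h2 : ‖p.1‖ * ‖x - y‖ ≤ ‖p.1‖ * ε := by gcongr; rwa [← hxy]
    rw [inner_sub_right] at h1
    exact max_le (by linarith) (by positivity)
  obtain ⟨c, hc, hcle⟩ := exists_infDist_le_mul_sum_posPart (s ∪ t) (hCD ▸ hne)
  refine ⟨c * (1 + ∑ p ∈ s ∪ t, ‖p.1‖), by positivity, fun x ε hxC hxD => ?_⟩
  have hε : 0 ≤ ε := infDist_nonneg.trans hxC
  rw [hCD]
  refine (hcle x).trans ?_
  rw [mul_assoc]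
  gcongr
  rw [add_mul, one_mul, Finset.sum_mul]
  refine le_trans (Finset.sum_le_sum fun p hp => ?_) (le_add_of_nonneg_left hε)
  rcases Finset.mem_union.1 hp with hp | hp
  · exact hviol s C hs hne.left x ε hxC p hp
  · exact hviol t D ht hne.right x ε hxD p hp

end Polyhedral

/-! ### Bounded linear regularity under a Slater condition. -/

section Regularity

variable {E : Type*} [NormedAddCommGroup E] [InnerProductSpace ℝ E]

theorem exists_ball_of_mem_intrinsicInterior {D : Set E} {p : E}
    (hp : p ∈ intrinsicInterior ℝ D) :
    ∃ r : ℝ, 0 < r ∧ ∀ y ∈ affineSpan ℝ D, ‖y - p‖ ≤ r → y ∈ D := by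
  obtain ⟨p', hp', rfl⟩ := mem_intrinsicInterior.1 hp
  obtain ⟨r, hr, hball⟩ := Metric.isOpen_iff.1 isOpen_interior p' hp'
  refine ⟨r / 2, by positivity, fun y hy hyr => ?_⟩
  have : (⟨y, hy⟩ : affineSpan ℝ D) ∈ ball p' r := by
    rw [mem_ball, Subtype.dist_eq, dist_eq_norm]
    exact hyr.trans_lt (by linarith)
  exact (interior_subset (hball this) : _ ∈ Subtype.val ⁻¹' D)

/-- Bounded linear regularity of an affine subspace `A` and a convex set `P ∩ f ⁻¹' D`, with `P`
polyhedral, when some point of `A ∩ P` is mapped by `f` into the relative interior of `D`. -/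
theorem exists_infDist_inter_le_of_slater [FiniteDimensional ℝ E] (A : AffineSubspace ℝ E)
    {P D : Set E} (hP : IsPolyhedral P) (hD : Convex ℝ D) (f : E →ₗ[ℝ] E) {p : E} (hpA : p ∈ A)
    (hpP : p ∈ P) (hpD : f p ∈ intrinsicInterior ℝ D) {B : Set E} (hB : Bornology.IsBounded B) :
    ∃ c : ℝ, 0 < c ∧ ∀ x ∈ B, ∀ ε : ℝ, infDist x (A : Set E) ≤ ε →
      infDist x (P ∩ f ⁻¹' D) ≤ ε → infDist x ((A : Set E) ∩ (P ∩ f ⁻¹' D)) ≤ c * ε := by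
  obtain ⟨r, hr, hball⟩ := exists_ball_of_mem_intrinsicInterior hpD
  have hpD' : f p ∈ D := intrinsicInterior_subset hpD
  have hDV : D ⊆ affineSpan ℝ D := subset_affineSpan ℝ D
  -- Replacing `D` by its affine hull makes everything polyhedral. The point `y` so obtained is then
  -- pulled towards the Slater point `p` until its image lies in `D`.
  have hW : IsPolyhedral (P ∩ f ⁻¹' (affineSpan ℝ D : Set E)) :=
    hP.inter ((isPolyhedral_affineSubspace _ ⟨_, hDV hpD'⟩).preimage f)
  have hApoly := isPolyhedral_affineSubspace A ⟨p, hpA⟩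
  have hQ := hApoly.inter hW
  set Q := (A : Set E) ∩ (P ∩ f ⁻¹' (affineSpan ℝ D : Set E)) with hQdef
  have hpQ : p ∈ Q := ⟨hpA, hpP, hDV hpD'⟩
  obtain ⟨c, hc, hcle⟩ := hApoly.exists_infDist_inter_le hW ⟨p, hpQ⟩
  obtain ⟨R, hR⟩ := hB.subset_closedBall p
  obtain ⟨M, hM, hfM⟩ : ∃ M : ℝ, 0 < M ∧ ∀ x, ‖f x‖ ≤ M * ‖x‖ :=
    ⟨‖f.toContinuousLinearMap‖ + 1, by positivity, fun x => by
      have := f.toContinuousLinearMap.le_opNorm x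
      simp only [LinearMap.coe_toContinuousLinearMap'] at this
      nlinarith [norm_nonneg x]⟩
  refine ⟨c + M * (c + 1) / r * (|R| + 1), by positivity, fun x hx ε hxA hxC => ?_⟩
  rw [← div_le_iff₀' (by positivity)]
  -- `D` need not be closed, so a nearest point may not exist; a strictly larger `ε'` supplies a
  -- point `d` within `ε'` instead.
  refine le_of_forall_gt_imp_ge_of_dense fun ε' hε' => ?_
  replace hxA := hxA.trans hε'.le
  replace hxC := hxC.trans_lt hε'
  replace hε' : 0 < ε' := infDist_nonneg.trans_lt hxC
  rw [div_le_iff₀' (by positivity)]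
  have hCne : (P ∩ f ⁻¹' D).Nonempty := ⟨p, hpP, hpD'⟩
  have hxW : infDist x (P ∩ f ⁻¹' (affineSpan ℝ D : Set E)) ≤ ε' :=
    (infDist_le_infDist_of_subset (inter_subset_inter_right _ (preimage_mono hDV)) hCne).trans hxC.le
  have hxQ := hcle x ε' hxA hxW
  obtain ⟨y, hy, hxy⟩ := exists_isProjOnto hQ.isClosed ⟨p, hpQ⟩ x
  rw [hxy] at hxQ
  have hyp : ‖y - p‖ ≤ |R| := by
    refine (hy.norm_sub_le hQ.convex hpQ).trans (le_trans ?_ (le_abs_self R))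
    rw [← dist_eq_norm]
    exact hR hx
  obtain ⟨d, hd, hxd⟩ := (infDist_lt_iff hCne).1 hxC
  rw [dist_eq_norm] at hxd
  have hyd : ‖y - d‖ ≤ (c + 1) * ε' := by
    have := norm_sub_le_norm_sub_add_norm_sub y x d
    rw [norm_sub_rev y x] at this
    linarith
  set δ := M * ((c + 1) * ε') with hδ
  have hδ0 : 0 < δ := by positivity
  have hfyd : ‖f y - f d‖ ≤ δ := by
    rw [← map_sub]
    exact (hfM _).trans (mul_le_mul_of_nonneg_left hyd hM.le)
  -- Chosen so that `t * (r / δ) = 1 - t`: then `f q` is exactly the convex combination of `f d` and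
  -- `e` with weights `1 - t` and `t`.
  set t := δ / (r + δ) with ht
  have ht0 : 0 < t := by positivity
  have ht1 : 1 - t = r / (r + δ) := by rw [ht]; field_simp; ring
  have ht1' : 0 ≤ 1 - t := by rw [ht1]; positivity
  set q := (1 - t) • y + t • p with hq
  have hqQ : q ∈ Q := hQ.convex hy.1 hpQ ht1' ht0.le (by ring)
  have hfq : f q ∈ D := by
    -- The error `f y - f d`, of norm at most `δ`, is rescaled to fit in the relative ball of radius
    -- `r` about `f p`.
    set e := f p + (r / δ) • (f y - f d) with he
    have heD : e ∈ D := by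
      refine hball e ?_ ?_
      · have := AffineSubspace.smul_vsub_vadd_mem (affineSpan ℝ D) (r / δ) hy.1.2.2 (hDV hd.2)
          (hDV hpD')
        rw [vsub_eq_sub, vadd_eq_add, add_comm] at this
        exact this
      · rw [he, add_sub_cancel_left, norm_smul, Real.norm_eq_abs, abs_of_pos (by positivity),
          div_mul_eq_mul_div, div_le_iff₀ hδ0]
        gcongr
    have hcomb : f q = (1 - t) • f d + t • e := by
      have htr : t * (r / δ) = 1 - t := by rw [ht1, ht]; field_simp
      rw [he, hq, map_add, map_smul, map_smul, smul_add, smul_smul, htr]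
      module
    rw [hcomb]
    exact hD hd.2 heD ht1' ht0.le (by ring)
  have hqmem : q ∈ (A : Set E) ∩ (P ∩ f ⁻¹' D) := ⟨hqQ.1, hqQ.2.1, hfq⟩
  have hyq : ‖y - q‖ ≤ δ / r * |R| := by
    rw [hq, show y - ((1 - t) • y + t • p) = t • (y - p) by module, norm_smul, Real.norm_eq_abs,
      abs_of_pos ht0]
    have htr : t ≤ δ / r := by rw [ht]; gcongr; linarith
    gcongr
  have h1 := infDist_le_dist_of_mem (x := x) hqmem
  have h2 := norm_sub_le_norm_sub_add_norm_sub x y q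
  rw [dist_eq_norm] at h1
  have h3 : δ / r * |R| ≤ M * (c + 1) / r * (|R| + 1) * ε' := by
    rw [hδ, show M * (c + 1) / r * (|R| + 1) * ε' = M * ((c + 1) * ε') / r * (|R| + 1) by ring]
    gcongr
    linarith
  linarith

end Regularity

/-! ### Linear regularity from the PPS condition. -/

section PartialPolyhedralSlater

variable {E : Type*} [NormedAddCommGroup E] [InnerProductSpace ℝ E]

/-- A common form for the three alternatives: `f` is zero with `D = univ` in the polyhedral case,
the identity with `P = univ` in the Slater case, and the projection on `E₂` along `E₁` in the
product case. -/
theorem PPS.exists_slater {K : ProperCone ℝ E} {A : AffineSubspace ℝ E} (h : PPS K A)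
    (hne : ((A : Set E) ∩ (K : Set E)).Nonempty) [FiniteDimensional ℝ E] :
    ∃ (P D : Set E) (f : E →ₗ[ℝ] E) (p : E), IsPolyhedral P ∧ Convex ℝ D ∧
      (K : Set E) = P ∩ f ⁻¹' D ∧ p ∈ A ∧ p ∈ P ∧ f p ∈ intrinsicInterior ℝ D := by
  rcases h with hK | ⟨p, hpA, hpK⟩ | ⟨E₁, E₂, K₁, K₂, hE, h₁, h₂, hK, hpoly, p, hpA, hp⟩
  · obtain ⟨p, hpA, hpK⟩ := hne
    refine ⟨K, univ, 0, p, hK, convex_univ, by simp, hpA, hpK, ?_⟩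
    exact interior_subset_intrinsicInterior (by simp)
  · exact ⟨univ, K, LinearMap.id, p, isPolyhedral_univ, convex_properCone K, by simp, hpA,
      mem_univ p, hpK⟩
  · have hf₁ : ∀ x ∈ E₁, ∀ y ∈ E₂, E₁.projection E₂ hE (x + y) = x := by
      intro x hx y hy
      rw [map_add, (Submodule.projection_eq_self_iff hE x).2 hx,
        (Submodule.projection_apply_eq_zero_iff hE).2 hy, add_zero]
    have hf₂ : ∀ x ∈ E₁, ∀ y ∈ E₂, E₂.projection E₁ hE.symm (x + y) = y := by
      intro x hx y hy
      rw [map_add, (Submodule.projection_eq_self_iff hE.symm y).2 hy,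
        (Submodule.projection_apply_eq_zero_iff hE.symm).2 hx, zero_add]
    obtain ⟨k₁, hk₁, k₂, hk₂, rfl⟩ := hp
    have hk₂' := intrinsicInterior_subset hk₂
    refine ⟨E₁.projection E₂ hE ⁻¹' K₁, K₂, E₂.projection E₁ hE.symm, k₁ + k₂,
      hpoly.preimage _, convex_properCone K₂, ?_, hpA, ?_, ?_⟩
    · rw [hK]
      ext x
      constructor
      · rintro ⟨x₁, hx₁, x₂, hx₂, rfl⟩
        refine ⟨?_, ?_⟩
        · rw [mem_preimage, hf₁ _ (h₁ hx₁) _ (h₂ hx₂)]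
          exact hx₁
        · rw [mem_preimage, hf₂ _ (h₁ hx₁) _ (h₂ hx₂)]
          exact hx₂
      · rintro ⟨hx₁, hx₂⟩
        exact ⟨_, hx₁, _, hx₂, Submodule.projection_add_projection_eq_self hE x⟩
    · rw [mem_preimage, hf₁ _ (h₁ hk₁) _ (h₂ hk₂')]
      exact hk₁
    · rw [hf₂ _ (h₁ hk₁) _ (h₂ hk₂')]
      exact hk₂

theorem PPS.exists_infNndist_inter_le [FiniteDimensional ℝ E] {K : ProperCone ℝ E}
    {A : AffineSubspace ℝ E} (h : PPS K A) (hne : ((A : Set E) ∩ (K : Set E)).Nonempty)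
    {B : Set E} (hB : Bornology.IsBounded B) :
    ∃ c : ℝ≥0, 0 < c ∧ ∀ x ∈ B, ∀ ε : ℝ≥0, infNndist x (A : Set E) ≤ ε →
      infNndist x (K : Set E) ≤ ε → infNndist x ((A : Set E) ∩ (K : Set E)) ≤ c * ε := by
  obtain ⟨P, D, f, p, hP, hD, hK, hpA, hpP, hpD⟩ := h.exists_slater hne
  obtain ⟨c, hc, hcle⟩ := exists_infDist_inter_le_of_slater A hP hD f hpA hpP hpD hB
  lift c to ℝ≥0 using hc.le
  refine ⟨c, by exact_mod_cast hc, fun x hx ε hA hK' => ?_⟩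
  rw [← NNReal.coe_le_coe, coe_infNndist] at *
  rw [hK] at hK' ⊢
  exact_mod_cast hcle x hx ε hA hK'

end PartialPolyhedralSlater

/-! ### From distances to `K` and `A` to the distance to the face. -/

section ErrorBound

variable {E : Type*} [NormedAddCommGroup E] [InnerProductSpace ℝ E]
  {K : ProperCone ℝ E} {z : E} {g : ℝ≥0 → ℝ≥0} {α : ℝ}

theorem inter_exposedFace_eq {A : Set E} (hA : ∀ x ∈ A, ⟪x, z⟫ = 0) :
    A ∩ exposedFace K z = A ∩ (K : Set E) := by
  ext x
  exact ⟨fun h => ⟨h.1, h.2.1⟩, fun h => ⟨h.1, h.2, hA x h.1⟩⟩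

theorem infNndist_exposedFace_le_psiFRF_of_subset [FiniteDimensional ℝ E] (hz : z ≠ 0)
    (hzK : z ∈ ProperCone.innerDual (K : Set E)) (hα : α ≤ 1)
    (hg : Monotone g) (hgα : ∀ t : ℝ≥0, t ^ α ≤ g t)
    (hγ : ∀ η : ℝ≥0, 0 < η → 0 < gammaConst K z g η) {A : AffineSubspace ℝ E}
    (hAne : (A : Set E).Nonempty) (hA : ∀ x ∈ A, ⟪x, z⟫ = 0) {x : E} {ε : ℝ≥0}
    (hxK : infNndist x (K : Set E) ≤ ε) (hxA : infNndist x (A : Set E) ≤ ε) :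
    infNndist x (exposedFace K z) ≤ psiFRF K z g α (max 1 ‖z‖₊ * ε) ‖x‖₊ := by
  refine infNndist_exposedFace_le_psiFRF hz hzK hα hg hgα hγ
    (hxK.trans (le_mul_of_one_le_left' (le_max_left _ _))) ?_
  -- Since `y ⊥ z`, `⟪x, z⟫ = ⟪x - y, z⟫ ≤ ε * ‖z‖`, whence the factor `max 1 ‖z‖`.
  obtain ⟨y, hy, hxy⟩ := exists_isProjOnto (isPolyhedral_affineSubspace A hAne).isClosed hAne x
  have h1 : ‖x - y‖ ≤ ε := by rw [← hxy, ← coe_infNndist]; exact_mod_cast hxA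
  have h2 := real_inner_le_norm (x - y) z
  rw [inner_sub_left, hA y hy.1, sub_zero] at h2
  have h3 : ‖z‖ ≤ (max 1 ‖z‖₊ : ℝ≥0) := by exact_mod_cast le_max_right 1 ‖z‖₊
  calc ⟪x, z⟫ ≤ ‖x - y‖ * ‖z‖ := h2
    _ ≤ ε * (max 1 ‖z‖₊ : ℝ≥0) := by gcongr
    _ = _ := by rw [mul_comm]; push_cast; rfl

end ErrorBound

/-! ### Optimality of the error bound. -/

section Optimality

variable {E : Type*} [NormedAddCommGroup E] [InnerProductSpace ℝ E]
  {K : ProperCone ℝ E} {z : E} {g : ℝ≥0 → ℝ≥0} {α : ℝ}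

theorem SubHomogeneous.exists_forall_le (hg : Monotone g) (h : SubHomogeneous g) (M : ℝ≥0) :
    ∃ S : ℝ≥0, 0 < S ∧ ∀ s ≤ S, g (M * s) ≤ max 1 M * g s := by
  obtain ⟨S, hS, hle⟩ := h
  refine ⟨S, hS, fun s hs => ?_⟩
  exact (hg (mul_le_mul_left (le_max_right 1 M) s)).trans (hle s hs _ (le_max_left 1 M))

theorem infDist_smul_le (K : ProperCone ℝ E) {c : ℝ} (hc : 0 < c) (x : E) :
    infDist (c • x) (K : Set E) ≤ c * infDist x (K : Set E) := by
  rw [← div_le_iff₀' hc]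
  refine (le_infDist (s := (K : Set E)) ⟨0, K.zero_mem⟩).2 fun {y} hy => ?_
  rw [div_le_iff₀' hc]
  refine (infDist_le_dist_of_mem (y := c • y) (K.smul_mem hy hc.le)).trans_eq ?_
  rw [dist_smul₀, Real.norm_of_nonneg hc.le]

theorem infDist_smul (K : ProperCone ℝ E) {c : ℝ} (hc : 0 < c) (x : E) :
    infDist (c • x) (K : Set E) = c * infDist x (K : Set E) := by
  refine le_antisymm (infDist_smul_le K hc x) ?_
  have := infDist_smul_le K (inv_pos.2 hc) (c • x)
  rwa [inv_smul_smul₀ hc.ne', inv_mul_eq_div, le_div_iff₀' hc] at this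

/-- Asymptotic optimality bounds `g` from above by any consistent error bound function for `K`
and `{z}^⊥`. -/
theorem AsymptoticallyOptimal.exists_le_mul {F : ProperCone ℝ E}
    (hF : (F : Set E) = exposedFace K z) (h : AsymptoticallyOptimal K z g) {H : Set E}
    (hH : H = {x | ⟪x, z⟫ = 0}) {Φ : ℝ≥0 → ℝ≥0 → ℝ≥0}
    (hΦ : IsConsistentErrorBound (K : Set E) H Φ) {η : ℝ≥0} (hη : 0 < η) :
    ∃ c s₀ : ℝ≥0, 0 < c ∧ 0 < s₀ ∧ ∀ s, 0 < s → s ≤ s₀ → g s ≤ c * Φ (c * s) η := by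
  obtain ⟨v, w, hv, hv0, hwc, hw, hlim, hsup⟩ := h
  obtain ⟨M, hM, hMtop⟩ := exists_between hsup
  lift M to ℝ≥0 using hMtop.ne
  have hvn : 0 < ‖v‖ := norm_pos_iff.2 hv0
  -- Near the limit `‖w ε‖ < 2 * ‖v‖`, so scaling by `c` lands in the ball of radius `η`.
  set c : ℝ≥0 := η / (2 * ‖v‖₊) with hc
  have hc0 : 0 < c := by
    have : 0 < ‖v‖₊ := by exact_mod_cast hvn
    positivity
  have hnear : ∀ᶠ ε in 𝓝[>] (0 : ℝ), ‖w ε‖ < 2 * ‖v‖ :=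
    hlim.norm.eventually_lt_const (by linarith)
  have hratio := eventually_lt_of_limsup_lt hM
  obtain ⟨ε₀, hε₀, hsub⟩ := mem_nhdsGT_iff_exists_Ioc_subset.1
    ((hnear.and hratio).and (Ioc_mem_nhdsGT one_pos))
  set d : ℝ → ℝ := fun ε => infDist (w ε) (K : Set E) with hd
  have hε₀' : (0 : ℝ) < ε₀ := hε₀
  have hIoc : Ioc 0 ε₀ ⊆ Ioc (0 : ℝ) 1 := fun ε hε => (hsub hε).2
  have hwK : ∀ ε ∈ Ioc (0 : ℝ) 1, 0 < d ε := by
    intro ε hε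
    refine (K.isClosed.notMem_iff_infDist_pos ⟨0, K.zero_mem⟩).1 fun hmem => (hw ε hε).2.2 ?_
    exact ⟨hmem, (hw ε hε).1⟩
  have hdc : ContinuousOn d (Ioc 0 ε₀) :=
    (continuous_infDist_pt (K : Set E)).comp_continuousOn (hwc.mono hIoc)
  have hd0 : Tendsto d (𝓝[>] 0) (𝓝 0) := by
    have h1 := ((continuous_infDist_pt (K : Set E)).tendsto v).comp hlim
    rwa [infDist_zero_of_mem hv.1] at h1
  have hdε₀ : 0 < d ε₀ := hwK _ (hIoc ⟨hε₀', le_rfl⟩)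
  -- `d` is continuous, tends to `0` and is positive at `ε₀`, so it takes every value in between.
  have hivt : ∀ s : ℝ, 0 < s → s ≤ d ε₀ → ∃ ε ∈ Ioc 0 ε₀, d ε = s := by
    intro s hs hsd
    obtain ⟨ε₁, hε₁s, hε₁⟩ := ((hd0.eventually_lt_const hs).and (Ioc_mem_nhdsGT hε₀')).exists
    have hss : Icc ε₁ ε₀ ⊆ Ioc 0 ε₀ := fun ε hε => ⟨hε₁.1.trans_le hε.1, hε.2⟩
    obtain ⟨ε, hε, hεs⟩ := intermediate_value_Icc hε₁.2 (hdc.mono hss) ⟨hε₁s.le, hsd⟩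
    exact ⟨ε, hss hε, hεs⟩
  refine ⟨max c (M / c), ⟨d ε₀, hdε₀.le⟩, lt_max_of_lt_left hc0, hdε₀, fun s hs hss => ?_⟩
  obtain ⟨ε, hε, hεs⟩ := hivt s hs hss
  obtain ⟨⟨hn, hr⟩, hε1⟩ := hsub hε
  obtain ⟨hwz, -, hwF⟩ := hw ε hε1
  have hs' : infNndist (w ε) (K : Set E) = s := by
    rw [← NNReal.coe_inj, coe_infNndist]
    exact hεs
  set f := infNndist (w ε) (exposedFace K z) with hf
  have hf0 : f ≠ 0 := by
    rw [← hF] at hwF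
    have := (F.isClosed.notMem_iff_infDist_pos ⟨0, F.zero_mem⟩).1 hwF
    rw [hF, ← coe_infNndist] at this
    exact_mod_cast this.ne'
  rw [hs', ← ENNReal.coe_div hf0, ENNReal.coe_lt_coe, div_lt_iff₀ (by positivity)] at hr
  have hcw : infNndist ((c : ℝ) • w ε) (K : Set E) = c * s := by
    rw [← hs', ← NNReal.coe_inj]
    push_cast [coe_infNndist]
    exact infDist_smul K (by exact_mod_cast hc0) _
  have hcf : infNndist ((c : ℝ) • w ε) (exposedFace K z) = c * f := by
    rw [hf, ← NNReal.coe_inj, ← hF]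
    push_cast [coe_infNndist]
    exact infDist_smul F (by exact_mod_cast hc0) _
  have hwH : (c : ℝ) • w ε ∈ H := by
    rw [hH, mem_ofPred_eq, real_inner_smul_left, hwz, mul_zero]
  have hwn : ‖(c : ℝ) • w ε‖₊ ≤ η := by
    rw [← NNReal.coe_le_coe, coe_nnnorm, norm_smul, Real.norm_of_nonneg (NNReal.coe_nonneg c), hc]
    push_cast
    rw [div_mul_eq_mul_div, div_le_iff₀ (by positivity)]
    gcongr
  have hKH : (K : Set E) ∩ H = exposedFace K z := by rw [hH, exposedFace_eq]
  have hb := hΦ.bound ((c : ℝ) • w ε)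
  have hwH0 : infNndist ((c : ℝ) • w ε) H = 0 := by
    rw [← NNReal.coe_inj, coe_infNndist, infDist_zero_of_mem hwH, NNReal.coe_zero]
  rw [hKH, hcf, hcw, hwH0, max_eq_left zero_le] at hb
  have hΦle : Φ (c * s) ‖(c : ℝ) • w ε‖₊ ≤ Φ (max c (M / c) * s) η :=
    (hΦ.mono_right _ hwn).trans (hΦ.mono_left _ (mul_le_mul_left (le_max_left _ _) s))
  calc g s ≤ M * f := hr.le
    _ = M / c * (c * f) := by field_simp
    _ ≤ max c (M / c) * Φ (max c (M / c) * s) η :=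
        mul_le_mul' (le_max_right _ _) (hb.trans hΦle)

theorem IsPosRescaledShift.exists_add_le_mul (hz : ‖z‖ = 1) (hα1 : α ≤ 1)
    (hg : Monotone g) (hgα : ∀ t : ℝ≥0, t ^ α ≤ g t) (hSH : SubHomogeneous g)
    {ψ : ℝ≥0 → ℝ≥0 → ℝ≥0} (hψ : IsPosRescaledShift (psiFRF K z g α) ψ) (η : ℝ≥0) :
    ∃ C S : ℝ≥0, 0 < S ∧ ∀ s ≤ S, s + ψ s η ≤ C * g s := by
  obtain ⟨M₁, M₂, M₃, M₄, -, -, -, hψ⟩ := hψ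
  obtain ⟨S, hS, hle⟩ := hSH.exists_forall_le hg (2 * M₁)
  have hz' : ‖z‖₊ = 1 := by rw [← NNReal.coe_inj]; simpa using hz
  -- The cap `1` on `s` ensures `s ≤ s ^ α ≤ g s`, which absorbs the linear terms into `g`.
  refine ⟨1 + M₃ * M₁ + M₄ + M₃ * kappaConst K z g α (M₂ * η) * max 1 (2 * M₁), min S 1,
    by positivity, fun s hs => ?_⟩
  have hsg : s ≤ g s := by
    refine le_trans ?_ (hgα s)
    rcases eq_zero_or_pos s with rfl | hs0
    · exact zero_le
    simpa using NNReal.rpow_le_rpow_of_exponent_ge hs0 (hs.trans (min_le_right _ _)) hα1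
  have h1 := hle s (hs.trans (min_le_left _ _))
  rw [hψ, psiFRF, hz', div_one, max_self, show M₁ * s + M₁ * s = 2 * M₁ * s by ring]
  calc s + (M₃ * (M₁ * s + kappaConst K z g α (M₂ * η) * g (2 * M₁ * s)) + M₄ * s)
      = (1 + M₃ * M₁ + M₄) * s + M₃ * kappaConst K z g α (M₂ * η) * g (2 * M₁ * s) := by ring
    _ ≤ (1 + M₃ * M₁ + M₄) * g s +
        M₃ * kappaConst K z g α (M₂ * η) * (max 1 (2 * M₁) * g s) := by gcongr
    _ = _ := by ring

theorem exists_add_le_mul_consistentErrorBound {F : ProperCone ℝ E}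
    (hF : (F : Set E) = exposedFace K z) (hz : ‖z‖ = 1) (hα1 : α ≤ 1)
    (hg : Monotone g) (hg0 : g 0 = 0) (hgα : ∀ t : ℝ≥0, t ^ α ≤ g t) (hSH : SubHomogeneous g)
    (hopt : AsymptoticallyOptimal K z g) {H : Set E} (hH : H = {x | ⟪x, z⟫ = 0})
    {ψ : ℝ≥0 → ℝ≥0 → ℝ≥0} (hψ : IsPosRescaledShift (psiFRF K z g α) ψ)
    {Φ : ℝ≥0 → ℝ≥0 → ℝ≥0} (hΦ : IsConsistentErrorBound (K : Set E) H Φ)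
    {η : ℝ≥0} (hη : 0 < η) :
    ∃ κ s₀ : ℝ≥0, 0 < κ ∧ 0 < s₀ ∧ ∀ s ≤ s₀, s + ψ s η ≤ κ * Φ (κ * s) η := by
  obtain ⟨C, S, hS, hC⟩ := hψ.exists_add_le_mul hz hα1 hg hgα hSH η
  obtain ⟨c, s₀, hc, hs₀, hle⟩ := hopt.exists_le_mul hF hH hΦ hη
  -- `C + 1` rather than `C`: the constant must be positive and at least `c`, as it also appears
  -- inside `Φ`.
  refine ⟨(C + 1) * c, min S s₀, by positivity, lt_min hS hs₀, fun s hs => ?_⟩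
  refine (hC s (hs.trans (min_le_left _ _))).trans ?_
  rcases eq_zero_or_pos s with rfl | hs0
  · simp [hg0]
  have h1 : Φ (c * s) η ≤ Φ ((C + 1) * c * s) η :=
    hΦ.mono_left η (mul_le_mul_left (le_mul_of_one_le_left' le_add_self) s)
  calc C * g s ≤ (C + 1) * (c * Φ (c * s) η) :=
        mul_le_mul' le_self_add (hle s hs0 (hs.trans (min_le_right _ _)))
    _ ≤ (C + 1) * c * Φ ((C + 1) * c * s) η := by rw [mul_assoc]; gcongr

end Optimality

/-! ### The main theorem. -/

theorem theorem3p6 {E : Type*} [NormedAddCommGroup E] [InnerProductSpace ℝ E]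
    [FiniteDimensional ℝ E] (L : Submodule ℝ E) (a : E) (F : ProperCone ℝ E)
    (hPPS : PPS F (AffineSubspace.mk' a L)) :
    -- `κ B` is chosen first, so that it depends only on `B`, `L`, `a` and `F`
    ∃ κ : Set E → ℝ≥0, (∀ B, 0 < κ B) ∧
      ∀ (K : ProperCone ℝ E) (z : E) (g : ℝ≥0 → ℝ≥0) (α : ℝ),
        ((AffineSubspace.mk' a L : Set E) ∩ (K : Set E)).Nonempty →
        z ∈ ProperCone.innerDual (K : Set E) → z ∈ Lᗮ → ⟪a, z⟫ = 0 →
        (F : Set E) = exposedFace K z → IsNontrivialFace K (F : Set E) →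
        0 < α → α ≤ 1 → Monotone g → g 0 = 0 → (∀ t : ℝ≥0, t ^ α ≤ g t) →
        (∀ η : ℝ≥0, 0 < η → 0 < gammaConst K z g η) →
        SubHomogeneous g → AsymptoticallyOptimal K z g →
        IsOneFRF K z (psiFRF K z g α) ∧
        (∃ ψ' : ℝ≥0 → ℝ≥0 → ℝ≥0, IsPosRescaledShift (psiFRF K z g α) ψ' ∧
          ∀ B : Set E, Bornology.IsBounded B → ∀ x ∈ B, ∀ ε : ℝ≥0,
            infNndist x (K : Set E) ≤ ε → infNndist x (AffineSubspace.mk' a L : Set E) ≤ ε →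
            infNndist x ((AffineSubspace.mk' a L : Set E) ∩ (K : Set E)) ≤
              κ B * (ε + ψ' ε (⨆ y : B, ‖(y : E)‖₊))) ∧
        (‖z‖ = 1 → L = (ℝ ∙ z)ᗮ → a = 0 →
          ∀ ψ' : ℝ≥0 → ℝ≥0 → ℝ≥0, IsPosRescaledShift (psiFRF K z g α) ψ' →
          ∀ Φ : ℝ≥0 → ℝ≥0 → ℝ≥0, IsConsistentErrorBound (K : Set E) (L : Set E) Φ →
          ∀ η : ℝ≥0, 0 < η → ∃ κ' s₀ : ℝ≥0, 0 < κ' ∧ 0 < s₀ ∧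
            ∀ s ≤ s₀, s + ψ' s η ≤ κ' * Φ (κ' * s) η) := by
  classical
  set A := AffineSubspace.mk' a L with hAdef
  have haA : a ∈ A := AffineSubspace.self_mem_mk' a L
  -- Nonemptiness of `A ∩ F` is known only once `K` and `z` are given, so it stays a premise; where
  -- a premise fails, `c` is the dummy value `1`.
  have hc : ∀ B : Set E, ∃ c : ℝ≥0, 0 < c ∧ (((A : Set E) ∩ (F : Set E)).Nonempty →
      Bornology.IsBounded B → ∀ x ∈ B, ∀ ε : ℝ≥0, infNndist x (A : Set E) ≤ ε →
      infNndist x (F : Set E) ≤ ε → infNndist x ((A : Set E) ∩ (F : Set E)) ≤ c * ε) := by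
    intro B
    by_cases h : ((A : Set E) ∩ (F : Set E)).Nonempty ∧ Bornology.IsBounded B
    · obtain ⟨c, hc, hle⟩ := hPPS.exists_infNndist_inter_le h.1 h.2
      exact ⟨c, hc, fun _ _ => hle⟩
    · exact ⟨1, one_pos, fun h1 h2 => absurd ⟨h1, h2⟩ h⟩
  choose κ hκ hκle using hc
  refine ⟨κ, hκ, fun K z g α hne hzK hzL haz hF hFnt _ hα1 hg hg0 hgα hγ hSH hopt => ?_⟩
  -- `z = 0` would expose all of `K`.
  have hz : z ≠ 0 := by
    rintro rfl
    exact hFnt.2 (by rw [hF]; simp [exposedFace])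
  have hAz : ∀ x ∈ A, ⟪x, z⟫ = 0 := by
    intro x hx
    have h1 : x - a ∈ L := by simpa [hAdef] using hx
    have h2 := (Submodule.mem_orthogonal L z).1 hzL _ h1
    rwa [inner_sub_left, haz, sub_zero] at h2
  have hAK : (A : Set E) ∩ (F : Set E) = (A : Set E) ∩ (K : Set E) := by
    rw [hF, inter_exposedFace_eq hAz]
  refine ⟨isOneFRF_psiFRF hz hzK hα1 hg hg0 hgα hγ, ?_, ?_⟩
  · refine ⟨fun ε t => psiFRF K z g α (max 1 ‖z‖₊ * ε) t,
      ⟨max 1 ‖z‖₊, 1, 1, 0, by positivity, one_pos, one_pos, by simp⟩, ?_⟩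
    intro B hB x hx ε hxK hxA
    have hFx := infNndist_exposedFace_le_psiFRF_of_subset hz hzK hα1 hg hgα hγ ⟨a, haA⟩ hAz
      hxK hxA
    have hbdd : BddAbove (range fun y : B => ‖(y : E)‖₊) := by
      obtain ⟨R, hR⟩ := hB.exists_norm_le
      refine ⟨R.toNNReal, ?_⟩
      rintro _ ⟨y, rfl⟩
      exact NNReal.le_toNNReal_of_coe_le (hR y y.2)
    have hxsup : ‖x‖₊ ≤ ⨆ y : B, ‖(y : E)‖₊ := le_ciSup hbdd ⟨x, hx⟩
    have hFx' := hFx.trans (psiFRF_mono_right hα1 hγ _ hxsup)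
    rw [← hAK]
    -- Regularity is applied with `ε + ψ'` as a common bound for the distances to `A` and to `F`.
    refine hκle B (hAK ▸ hne) hB x hx _ (hxA.trans le_self_add) ?_
    rw [hF]
    exact hFx'.trans le_add_self
  · rintro hz1 hL - ψ' hψ' Φ hΦ η hη
    refine exists_add_le_mul_consistentErrorBound hF hz1 hα1 hg hg0 hgα hSH hopt ?_ hψ' hΦ hη
    ext x
    rw [hL, SetLike.mem_coe, Submodule.mem_orthogonal_singleton_iff_inner_left]
    rfl
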